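/- Let $n\ge 0$ and let $\Omega\subset\mathbb R^n$ be an open set. For an open set $U\subset\mathbb R^n$ let $C_0^\infty(U)$ be the set of smooth functions $u:\mathbb R^n\to\mathbb R$ with compact support contained in $U$. For $q>1$ and a compact set $K\subset U$, the variational $q$-capacity is $$\operatorname{cap}_q(K,U)=\inf\Big\{\int_U|\nabla u|^q\,dx:\ u\in C_0^\infty(U),\ u\ge 1\text{ on }K\Big\}.$$ A closed set $E\subset\mathbb R^n$ is called uniformly $q$-fat if there is a constant $c>0$ such that $$\operatorname{cap}_q\big(E\cap\overline B(x,r),B(x,2r)\big)\ \ge\ c\,r^{n-q}\qquad\text{for all }x\in E\text{ and all }r>0.$$ Let $s\ge 1$, and assume that $\mathbb R^n\setminus\Omega$ is uniformly $q$-fat for every real $q>s$ (with a constant that may depend on $q$). Let $1<p<\infty$ and let $\beta\in\mathbb R$ with $\beta<p-s$. Then $\Omega$ admits the $(p,\beta)$-Hardy inequality: there is a constant $C>0$ such that $$\int_\Omega|u(x)|^p\,d_\Omega(x)^{\beta-p}\,dx\ \le\ C\int_\Omega|\nabla u(x)|^p\,d_\Omega(x)^{\beta}\,dx\qquad\text{for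 every }u\in C_0^\infty(\Omega),$$ where $d_\Omega(x)=\operatorname{dist}(x,\partial\Omega)$. (If $\partial\Omega=\emptyset$, then $d_\Omega=\infty$ on $\Omega$ and $\infty^{\beta-p}=0$, so the inequality holds trivially.) -/

import Mathlib

open MeasureTheory
open scoped ENNReal NNReal ContDiff

/-- The class `C₀^∞(U)`: smooth real functions on `ℝⁿ` with compact support contained in `U`. -/
def IsTestFunction {n : ℕ} (U : Set (EuclideanSpace ℝ (Fin n)))
    (u : EuclideanSpace ℝ (Fin n) → ℝ) : Prop :=
  ContDiff ℝ ∞ u ∧ HasCompactSupport u ∧ tsupport u ⊆ U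

/-- The variational `q`-capacity of the condenser `(K, U)`: the infimum of `∫_U |∇u|^q dx` over all
`u ∈ C₀^∞(U)` with `u ≥ 1` on `K`. The operator norm of `fderiv ℝ u x` is the Euclidean norm of the
gradient of `u` at `x`. -/
noncomputable def variationalCapacity {n : ℕ} (q : ℝ)
    (K U : Set (EuclideanSpace ℝ (Fin n))) : ℝ≥0∞ :=
  ⨅ (u : EuclideanSpace ℝ (Fin n) → ℝ) (_ : IsTestFunction U u) (_ : ∀ x ∈ K, 1 ≤ u x),
    ∫⁻ x in U, ‖fderiv ℝ u x‖ₑ ^ q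

/-- Uniform `q`-fatness of a closed set `E ⊆ ℝⁿ`: at every point of `E` and at every scale `r`, the
`q`-capacity of `E` is bounded below by a fixed multiple of `r ^ (n - q)`, the order of the
`q`-capacity of a full ball of radius `r`. -/
def UniformlyFat {n : ℕ} (q : ℝ) (E : Set (EuclideanSpace ℝ (Fin n))) : Prop :=
  ∃ c : ℝ, 0 < c ∧ ∀ x ∈ E, ∀ r : ℝ, 0 < r →
    ENNReal.ofReal (c * r ^ ((n : ℝ) - q)) ≤
      variationalCapacity q (E ∩ Metric.closedBall x r) (Metric.ball x (2 * r))

/-- `Ω` admits the `(p, β)`-Hardy inequality: for some finite `C > 0` and all `u ∈ C₀^∞(Ω)`,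
`∫_Ω |u|^p d^(β - p) dx ≤ C ∫_Ω |∇u|^p d^β dx`, with `d x = dist(x, ∂Ω)`. The distance takes values
in `[0, ∞]`; for `x ∈ Ω` it is positive, and it is infinite exactly when `∂Ω` is empty. -/
def AdmitsHardyInequality {n : ℕ} (p β : ℝ) (Ω : Set (EuclideanSpace ℝ (Fin n))) : Prop :=
  ∃ C : ℝ≥0, 0 < C ∧ ∀ u : EuclideanSpace ℝ (Fin n) → ℝ, IsTestFunction Ω u →
    ∫⁻ x in Ω, ‖u x‖ₑ ^ p * Metric.infEDist x (frontier Ω) ^ (β - p) ≤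
      (C : ℝ≥0∞) * ∫⁻ x in Ω, ‖fderiv ℝ u x‖ₑ ^ p * Metric.infEDist x (frontier Ω) ^ β

/-!
A single exponent `q < p - β` suffices. At the scale `D` of the distance from `x` to the complement
`F`, suppose that `u` vanishes on `F` but has a large mean on `ball x D`. Then around each point of
`F` near `x` some ball of radius `ρ ≲ D` carries gradient mass at least of the order
`ρ ^ (n - 1 + δ)`, and weighting the gradient by a negative power of the distance to `F` turns this
into `ρ ^ (n - q)`. A Vitali subfamily of these balls covers `F` near `x` after enlargement; gluing
bump functions bounds the `q`-capacity of that set by the sum of the `ρ ^ (n - q)`, so fatness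
bounds the weighted gradient mass near `x` from below.

Integrating the local estimate over `x` against a power of the distance gives, by Tonelli, the Hardy
inequality with exponent `1` for every weight beyond `q`. Applying it to `|u| ^ p`, Hölder's
inequality and absorption give exponent `p`.
-/

open Metric Module

section Scaling

variable {E : Type*} [NormedAddCommGroup E] [NormedSpace ℝ E] [FiniteDimensional ℝ E]
  [MeasurableSpace E] [BorelSpace E] (μ : Measure E) [μ.IsAddHaarMeasure]

theorem lintegral_comp_smul (f : E → ℝ≥0∞) {t : ℝ} (ht : 0 < t) :
    ∫⁻ z, f (t • z) ∂μ = ENNReal.ofReal (t ^ (-(finrank ℝ E : ℝ))) * ∫⁻ y, f y ∂μ := by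
  have hmap : ∫⁻ y, f y ∂(Measure.map (t • ·) μ) = ∫⁻ z, f (t • z) ∂μ :=
    (Homeomorph.smulOfNeZero t ht.ne').measurableEmbedding.lintegral_map f
  rw [← hmap, Measure.map_addHaar_smul μ ht.ne', lintegral_smul_measure, smul_eq_mul,
    abs_of_pos (by positivity), Real.rpow_neg ht.le, Real.rpow_natCast]

theorem lintegral_comp_inv_smul_sub (f : E → ℝ≥0∞) (w : E) {ρ : ℝ} (hρ : 0 < ρ) :
    ∫⁻ x, f (ρ⁻¹ • (x - w)) ∂μ = ENNReal.ofReal (ρ ^ (finrank ℝ E : ℝ)) * ∫⁻ y, f y ∂μ := by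
  rw [lintegral_sub_right_eq_self (fun x => f (ρ⁻¹ • x)), lintegral_comp_smul μ f (inv_pos.2 hρ),
    Real.inv_rpow hρ.le, Real.rpow_neg hρ.le, inv_inv]

theorem lintegral_enorm_fderiv_comp_inv_smul_sub (f : E → ℝ) {q : ℝ} (hq : 0 ≤ q) (w : E) {ρ : ℝ}
    (hρ : 0 < ρ) :
    ∫⁻ x, ‖fderiv ℝ (fun y => f (ρ⁻¹ • (y - w))) x‖ₑ ^ q ∂μ =
      ENNReal.ofReal (ρ ^ ((finrank ℝ E : ℝ) - q)) * ∫⁻ x, ‖fderiv ℝ f x‖ₑ ^ q ∂μ := by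
  have hderiv (x : E) : ‖fderiv ℝ (fun y => f (ρ⁻¹ • (y - w))) x‖ₑ ^ q =
      ENNReal.ofReal (ρ ^ (-q)) * ‖fderiv ℝ f (ρ⁻¹ • (x - w))‖ₑ ^ q := by
    rw [fderiv_comp_sub (f := fun z => f (ρ⁻¹ • z)), fderiv_comp_smul, enorm_smul,
      ENNReal.mul_rpow_of_nonneg _ _ hq, Real.enorm_of_nonneg (inv_pos.2 hρ).le,
      ENNReal.ofReal_rpow_of_pos (inv_pos.2 hρ), Real.inv_rpow hρ.le, Real.rpow_neg hρ.le]
  simp only [hderiv]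
  rw [lintegral_const_mul' _ _ ENNReal.ofReal_ne_top,
    lintegral_comp_inv_smul_sub μ (fun x => ‖fderiv ℝ f x‖ₑ ^ q) w hρ, ← mul_assoc,
    ← ENNReal.ofReal_mul (by positivity), ← Real.rpow_add hρ, neg_add_eq_sub]

theorem lintegral_add_dist_rpow_neg (r : ℝ) (y : E) {D : ℝ} (hD : 0 < D) :
    ∫⁻ x, ENNReal.ofReal ((D + dist x y) ^ (-r)) ∂μ =
      ENNReal.ofReal (D ^ (finrank ℝ E - r)) *
        ∫⁻ z, ENNReal.ofReal ((1 + ‖z‖) ^ (-r)) ∂μ := by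
  have hscale (x : E) : ENNReal.ofReal ((D + dist x y) ^ (-r)) =
      ENNReal.ofReal (D ^ (-r)) * ENNReal.ofReal ((1 + ‖D⁻¹ • (x - y)‖) ^ (-r)) := by
    rw [← ENNReal.ofReal_mul (by positivity), ← Real.mul_rpow hD.le (by positivity), norm_smul,
      norm_inv, Real.norm_of_nonneg hD.le, dist_eq_norm, mul_add, mul_one,
      mul_inv_cancel_left₀ hD.ne']
  simp only [hscale]
  rw [lintegral_const_mul' _ _ ENNReal.ofReal_ne_top,
    lintegral_comp_inv_smul_sub μ (fun z => ENNReal.ofReal ((1 + ‖z‖) ^ (-r))) y hD, ← mul_assoc,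
    ← ENNReal.ofReal_mul (by positivity), ← Real.rpow_add hD, neg_add_eq_sub]

end Scaling

section MeanOscillation

variable {E : Type*} [NormedAddCommGroup E] [NormedSpace ℝ E]

theorem enorm_add_sub_le_lintegral_enorm_fderiv {u : E → ℝ} (hu : ContDiff ℝ 1 u) (w z : E) :
    ‖u (w + z) - u w‖ₑ ≤ (∫⁻ t in Set.Ioc (0 : ℝ) 1, ‖fderiv ℝ u (w + t • z)‖ₑ) * ‖z‖ₑ := by
  have hcont : Continuous fun t : ℝ => fderiv ℝ u (w + t • z) z :=
    ((hu.continuous_fderiv one_ne_zero).comp (by fun_prop)).clm_apply continuous_const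
  have hderiv (t : ℝ) : HasDerivAt (fun t : ℝ => u (w + t • z)) (fderiv ℝ u (w + t • z) z) t := by
    have hray : HasDerivAt (fun t : ℝ => w + t • z) z t := by
      simpa using ((hasDerivAt_id t).smul_const z).const_add w
    exact (hu.differentiable one_ne_zero _).hasFDerivAt.comp_hasDerivAt t hray
  have hftc : ∫ t in Set.Ioc (0 : ℝ) 1, fderiv ℝ u (w + t • z) z = u (w + z) - u w := by
    rw [← intervalIntegral.integral_of_le zero_le_one,
      intervalIntegral.integral_eq_sub_of_hasDerivAt (fun t _ => hderiv t)
        (hcont.intervalIntegrable _ _), one_smul, zero_smul, add_zero]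
  rw [← hftc, ← lintegral_mul_const' _ _ enorm_ne_top]
  exact (enorm_integral_le_lintegral_enorm _).trans
    (lintegral_mono fun t => ContinuousLinearMap.le_opENorm _ _)

theorem lintegral_Ioc_rpow_sub_one {δ : ℝ} (hδ : 0 < δ) :
    ∫⁻ t in Set.Ioc (0 : ℝ) 1, ENNReal.ofReal (t ^ (δ - 1)) = ENNReal.ofReal δ⁻¹ := by
  have hint : IntervalIntegrable (fun t : ℝ => t ^ (δ - 1)) volume 0 1 :=
    intervalIntegral.intervalIntegrable_rpow' (by linarith)
  rw [← ofReal_integral_eq_lintegral_ofReal]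
  · rw [← intervalIntegral.integral_of_le zero_le_one, integral_rpow (Or.inl (by linarith)),
      sub_add_cancel, Real.one_rpow, Real.zero_rpow hδ.ne', sub_zero, one_div]
  · exact (intervalIntegrable_iff_integrableOn_Ioc_of_le zero_le_one).1 hint
  · filter_upwards [ae_restrict_mem measurableSet_Ioc] with t ht
    exact Real.rpow_nonneg ht.1.le _

variable [FiniteDimensional ℝ E] [MeasurableSpace E] [BorelSpace E]
  (μ : Measure E) [μ.IsAddHaarMeasure]

theorem lintegral_ball_comp_add_smul (f : E → ℝ≥0∞) (w : E) {t R : ℝ} (ht : 0 < t) :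
    ∫⁻ z in ball 0 R, f (w + t • z) ∂μ =
      ENNReal.ofReal (t ^ (-(finrank ℝ E : ℝ))) * ∫⁻ y in ball w (t * R), f y ∂μ := by
  have hmem (z : E) : w + t • z ∈ ball w (t * R) ↔ z ∈ ball 0 R := by
    simp [dist_eq_norm, norm_smul, abs_of_pos ht, ht]
  calc ∫⁻ z in ball 0 R, f (w + t • z) ∂μ
      = ∫⁻ z, (ball w (t * R)).indicator f (w + t • z) ∂μ := by
        rw [← lintegral_indicator measurableSet_ball]
        exact lintegral_congr fun z => Set.indicator_eq_indicator (hmem z).symm rfl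
    _ = ENNReal.ofReal (t ^ (-(finrank ℝ E : ℝ))) *
          ∫⁻ y, (ball w (t * R)).indicator f (w + y) ∂μ :=
        lintegral_comp_smul μ (fun y => (ball w (t * R)).indicator f (w + y)) ht
    _ = _ := by rw [lintegral_add_left_eq_self, lintegral_indicator measurableSet_ball]

theorem lintegral_ball_enorm_sub_le {u : E → ℝ} (hu : ContDiff ℝ 1 u) (w : E) (R : ℝ) :
    ∫⁻ y in ball w R, ‖u y - u w‖ₑ ∂μ ≤
      (∫⁻ t in Set.Ioc (0 : ℝ) 1, ENNReal.ofReal (t ^ (-(finrank ℝ E : ℝ))) *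
        ∫⁻ y in ball w (t * R), ‖fderiv ℝ u y‖ₑ ∂μ) * ENNReal.ofReal R := by
  have hu' : Continuous (fderiv ℝ u) := hu.continuous_fderiv one_ne_zero
  have hjoint : Measurable fun p : E × ℝ => ‖fderiv ℝ u (w + p.2 • p.1)‖ₑ :=
    (hu'.comp (by fun_prop : Continuous fun p : E × ℝ => w + p.2 • p.1)).enorm.measurable
  calc ∫⁻ y in ball w R, ‖u y - u w‖ₑ ∂μ
      = ∫⁻ z in ball 0 R, ‖u (w + z) - u w‖ₑ ∂μ := by
        have h := lintegral_ball_comp_add_smul μ (fun y => ‖u y - u w‖ₑ) w (R := R) one_pos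
        simp only [one_smul, one_mul, Real.one_rpow, ENNReal.ofReal_one] at h
        exact h.symm
    _ ≤ ∫⁻ z in ball 0 R, (∫⁻ t in Set.Ioc (0 : ℝ) 1, ‖fderiv ℝ u (w + t • z)‖ₑ) *
          ENNReal.ofReal R ∂μ := by
        refine setLIntegral_mono' measurableSet_ball fun z hz =>
          (enorm_add_sub_le_lintegral_enorm_fderiv hu w z).trans ?_
        rw [← ofReal_norm z]
        gcongr
        exact (mem_ball_zero_iff.1 hz).le
    _ = (∫⁻ t in Set.Ioc (0 : ℝ) 1, ∫⁻ z in ball 0 R, ‖fderiv ℝ u (w + t • z)‖ₑ ∂μ) *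
          ENNReal.ofReal R := by
        rw [lintegral_mul_const' _ _ ENNReal.ofReal_ne_top,
          lintegral_lintegral_swap hjoint.aemeasurable]
    _ = _ := by
        congr 1
        exact setLIntegral_congr_fun measurableSet_Ioc fun t ht =>
          lintegral_ball_comp_add_smul μ (fun y => ‖fderiv ℝ u y‖ₑ) w ht.1

theorem lintegral_ball_enorm_sub_le_of_decay {u : E → ℝ} (hu : ContDiff ℝ 1 u) {w : E}
    {a R δ : ℝ} (ha : 0 ≤ a) (hR : 0 < R) (hδ : 0 < δ)
    (hdecay : ∀ ρ ∈ Set.Ioc 0 R, ∫⁻ y in ball w ρ, ‖fderiv ℝ u y‖ₑ ∂μ ≤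
      ENNReal.ofReal (a * ρ ^ (finrank ℝ E - 1 + δ))) :
    ∫⁻ y in ball w R, ‖u y - u w‖ₑ ∂μ ≤ ENNReal.ofReal (a * R ^ (finrank ℝ E + δ) / δ) := by
  set m : ℝ := (finrank ℝ E : ℝ)
  have hpow (t : ℝ) (ht : 0 < t) : t ^ (δ - 1) = t ^ (-m) * t ^ (m - 1 + δ) := by
    rw [← Real.rpow_add ht]
    ring_nf
  calc ∫⁻ y in ball w R, ‖u y - u w‖ₑ ∂μ
      ≤ (∫⁻ t in Set.Ioc (0 : ℝ) 1, ENNReal.ofReal (t ^ (-m)) *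
          ∫⁻ y in ball w (t * R), ‖fderiv ℝ u y‖ₑ ∂μ) * ENNReal.ofReal R :=
        lintegral_ball_enorm_sub_le μ hu w R
    _ ≤ (∫⁻ t in Set.Ioc (0 : ℝ) 1, ENNReal.ofReal (a * R ^ (m - 1 + δ)) *
          ENNReal.ofReal (t ^ (δ - 1))) * ENNReal.ofReal R := by
        gcongr ?_ * _
        refine setLIntegral_mono' measurableSet_Ioc fun t ht => ?_
        have ht0 : 0 < t := ht.1
        refine (mul_le_mul_right (hdecay (t * R)
          ⟨by positivity, mul_le_of_le_one_left hR.le ht.2⟩) _).trans_eq ?_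
        rw [← ENNReal.ofReal_mul (by positivity), ← ENNReal.ofReal_mul (by positivity),
          Real.mul_rpow ht0.le hR.le, hpow t ht0]
        congr 1
        ring
    _ = ENNReal.ofReal (a * R ^ (m + δ) / δ) := by
        rw [lintegral_const_mul' _ _ ENNReal.ofReal_ne_top, lintegral_Ioc_rpow_sub_one hδ,
          ← ENNReal.ofReal_mul (by positivity), ← ENNReal.ofReal_mul (by positivity),
          show m + δ = m - 1 + δ + 1 by ring, Real.rpow_add_one hR.ne']
        congr 1
        ring

theorem exists_radius_le_lintegral_ball_fderiv {u : E → ℝ} (hu : ContDiff ℝ 1 u) {w : E}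
    {a R δ : ℝ} (ha : 0 ≤ a) (hR : 0 < R) (hδ : 0 < δ)
    (hlt : ENNReal.ofReal (a * R ^ (finrank ℝ E + δ) / δ) <
      ∫⁻ y in ball w R, ‖u y - u w‖ₑ ∂μ) :
    ∃ ρ ∈ Set.Ioc 0 R, ENNReal.ofReal (a * ρ ^ (finrank ℝ E - 1 + δ)) ≤
      ∫⁻ y in ball w ρ, ‖fderiv ℝ u y‖ₑ ∂μ := by
  contrapose! hlt
  exact lintegral_ball_enorm_sub_le_of_decay μ hu ha hR hδ fun ρ hρ => (hlt ρ hρ).le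

end MeanOscillation

section LqNorm

variable {ι E : Type*} [NormedAddCommGroup E] [NormedSpace ℝ E] {q : ℝ} {s : Finset ι}

/-- The `ℓ^q` norm of a finite family of nonnegative numbers. It serves as a smooth substitute for
the maximum of the family. -/
noncomputable def lqNorm (q : ℝ) (s : Finset ι) (a : ι → ℝ) : ℝ :=
  (∑ i ∈ s, a i ^ q) ^ q⁻¹

theorem lqNorm_const (hq : q ≠ 0) {c : ℝ} (hc : 0 ≤ c) :
    lqNorm q s (fun _ => c) = (s.card : ℝ) ^ q⁻¹ * c := by
  rw [lqNorm, Finset.sum_const, nsmul_eq_mul, Real.mul_rpow (Nat.cast_nonneg _) (by positivity),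
    Real.rpow_rpow_inv hc hq]

theorem le_lqNorm (hq : 0 < q) {a : ι → ℝ} (ha : ∀ i ∈ s, 0 ≤ a i) {i : ι} (hi : i ∈ s) :
    a i ≤ lqNorm q s a := by
  rw [lqNorm, Real.le_rpow_inv_iff_of_pos (ha i hi)
    (Finset.sum_nonneg fun j hj => Real.rpow_nonneg (ha j hj) q) hq]
  exact Finset.single_le_sum (fun j hj => Real.rpow_nonneg (ha j hj) q) hi

theorem sum_rpow_pos (hs : s.Nonempty) {a : ι → ℝ} (ha : ∀ i ∈ s, 0 < a i) :
    0 < ∑ i ∈ s, a i ^ q :=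
  Finset.sum_pos (fun i hi => Real.rpow_pos_of_pos (ha i hi) q) hs

theorem contDiff_lqNorm (hs : s.Nonempty) {f : ι → E → ℝ} (hpos : ∀ i ∈ s, ∀ x, 0 < f i x)
    (hf : ∀ i ∈ s, ContDiff ℝ ∞ (f i)) : ContDiff ℝ ∞ fun x => lqNorm q s (f · x) :=
  (ContDiff.sum fun i hi => (hf i hi).rpow_const_of_ne fun x => (hpos i hi x).ne').rpow_const_of_ne
    fun x => (sum_rpow_pos hs fun i hi => hpos i hi x).ne'

theorem differentiableAt_lqNorm (hs : s.Nonempty) {f : ι → E → ℝ} {x : E}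
    (hpos : ∀ i ∈ s, 0 < f i x) (hf : ∀ i ∈ s, DifferentiableAt ℝ (f i) x) :
    DifferentiableAt ℝ (fun y => lqNorm q s (f · y)) x :=
  (DifferentiableAt.fun_sum fun i hi => (hf i hi).rpow_const (Or.inl (hpos i hi).ne')).rpow_const
    (Or.inl (sum_rpow_pos hs hpos).ne')

theorem sum_rpow_sub_one_mul_le (hq : 1 ≤ q) {a b : ι → ℝ} (ha : ∀ i ∈ s, 0 < a i)
    (hb : ∀ i, 0 ≤ b i) :
    ∑ i ∈ s, a i ^ (q - 1) * b i ≤ (∑ i ∈ s, a i ^ q) ^ (1 - q⁻¹) * lqNorm q s b := by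
  have hholder := Real.inner_le_weight_mul_Lp_of_nonneg s hq (fun i => |a i| ^ q)
    (fun i => b i / |a i|) (fun i => by positivity) fun i => div_nonneg (hb i) (abs_nonneg _)
  convert hholder using 1
  · refine Finset.sum_congr rfl fun i hi => ?_
    rw [abs_of_pos (ha i hi), Real.rpow_sub_one (ha i hi).ne']
    ring
  · rw [lqNorm]
    congr 2
    · exact Finset.sum_congr rfl fun i hi => by rw [abs_of_pos (ha i hi)]
    · refine Finset.sum_congr rfl fun i hi => ?_
      rw [abs_of_pos (ha i hi), ← Real.mul_rpow (ha i hi).le (div_nonneg (hb i) (ha i hi).le),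
        mul_div_cancel₀ _ (ha i hi).ne']

theorem enorm_rpow_eq_ofReal_norm_rpow {F : Type*} [SeminormedAddCommGroup F] (x : F)
    (hq : 0 ≤ q) : ‖x‖ₑ ^ q = ENNReal.ofReal (‖x‖ ^ q) := by
  rw [← ENNReal.ofReal_rpow_of_nonneg (norm_nonneg x) hq, ofReal_norm]

theorem norm_fderiv_lqNorm_le (hs : s.Nonempty) (hq : 1 ≤ q) {f : ι → E → ℝ} {x : E}
    (hpos : ∀ i ∈ s, 0 < f i x) (hf : ∀ i ∈ s, DifferentiableAt ℝ (f i) x) :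
    ‖fderiv ℝ (fun y => lqNorm q s (f · y)) x‖ ≤ lqNorm q s fun i => ‖fderiv ℝ (f i) x‖ := by
  have : 0 < q := zero_lt_one.trans_le hq
  set S := ∑ i ∈ s, f i x ^ q
  have hS : 0 < S := sum_rpow_pos hs hpos
  have hsum : HasFDerivAt (fun y => ∑ i ∈ s, f i y ^ q)
      (∑ i ∈ s, (q * f i x ^ (q - 1)) • fderiv ℝ (f i) x) x :=
    HasFDerivAt.fun_sum fun i hi => (hf i hi).hasFDerivAt.rpow_const (Or.inl (hpos i hi).ne')
  calc ‖fderiv ℝ (fun y => lqNorm q s (f · y)) x‖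
      = q⁻¹ * S ^ (q⁻¹ - 1) * ‖∑ i ∈ s, (q * f i x ^ (q - 1)) • fderiv ℝ (f i) x‖ := by
        simp only [lqNorm]
        rw [(hsum.rpow_const (Or.inl hS.ne')).fderiv, norm_smul,
          Real.norm_of_nonneg (by positivity)]
    _ ≤ q⁻¹ * S ^ (q⁻¹ - 1) * ∑ i ∈ s, q * (f i x ^ (q - 1) * ‖fderiv ℝ (f i) x‖) := by
        gcongr
        refine norm_sum_le_of_le _ fun i hi => ?_
        have := hpos i hi
        rw [norm_smul, Real.norm_of_nonneg (by positivity), mul_assoc]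
    _ ≤ q⁻¹ * S ^ (q⁻¹ - 1) *
          (q * (S ^ (1 - q⁻¹) * lqNorm q s fun i => ‖fderiv ℝ (f i) x‖)) := by
        rw [← Finset.mul_sum]
        gcongr
        exact sum_rpow_sub_one_mul_le hq hpos fun i => norm_nonneg _
    _ = S ^ (q⁻¹ - 1) * S ^ (1 - q⁻¹) * lqNorm q s fun i => ‖fderiv ℝ (f i) x‖ := by
        field_simp
    _ = lqNorm q s fun i => ‖fderiv ℝ (f i) x‖ := by
        rw [← Real.rpow_add hS, sub_add_sub_cancel, sub_self, Real.rpow_zero, one_mul]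

theorem enorm_fderiv_lqNorm_rpow_le (hs : s.Nonempty) (hq : 1 ≤ q) {f : ι → E → ℝ} {x : E}
    (hpos : ∀ i ∈ s, 0 < f i x) (hf : ∀ i ∈ s, DifferentiableAt ℝ (f i) x) :
    ‖fderiv ℝ (fun y => lqNorm q s (f · y)) x‖ₑ ^ q ≤ ∑ i ∈ s, ‖fderiv ℝ (f i) x‖ₑ ^ q := by
  have hq0 : 0 < q := zero_lt_one.trans_le hq
  simp only [enorm_rpow_eq_ofReal_norm_rpow _ hq0.le]
  rw [← ENNReal.ofReal_sum_of_nonneg fun _ _ => by positivity]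
  refine ENNReal.ofReal_le_ofReal ((Real.rpow_le_rpow (norm_nonneg _)
    (norm_fderiv_lqNorm_le hs hq hpos hf) hq0.le).trans_eq ?_)
  exact Real.rpow_inv_rpow (by positivity) hq0.ne'

theorem enorm_fderiv_two_mul_lqNorm_add_sub_rpow_le (hs : s.Nonempty) (hq : 1 ≤ q)
    {f : ι → E → ℝ} {x : E} {η : ℝ} (hpos : ∀ i ∈ s, 0 < f i x + η)
    (hf : ∀ i ∈ s, DifferentiableAt ℝ (f i) x) (c : ℝ) :
    ‖fderiv ℝ (fun y => 2 * (lqNorm q s (f · y + η) - c)) x‖ₑ ^ q ≤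
      ENNReal.ofReal (2 ^ q) * ∑ i ∈ s, ‖fderiv ℝ (f i) x‖ₑ ^ q := by
  have hq0 : 0 < q := zero_lt_one.trans_le hq
  have hf' : ∀ i ∈ s, DifferentiableAt ℝ (fun y => f i y + η) x :=
    fun i hi => (hf i hi).add_const η
  have hle := enorm_fderiv_lqNorm_rpow_le hs hq (f := fun i y => f i y + η) hpos hf'
  simp only [fderiv_add_const] at hle
  have hlq := differentiableAt_lqNorm (q := q) hs (f := fun i y => f i y + η) hpos hf'
  rw [fderiv_const_mul (hlq.sub_const c), fderiv_sub_const, enorm_smul,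
    ENNReal.mul_rpow_of_nonneg _ _ hq0.le, enorm_rpow_eq_ofReal_norm_rpow _ hq0.le,
    Real.norm_ofNat]
  gcongr

end LqNorm

section Capacity

variable {n : ℕ} {q : ℝ} {K U : Set (EuclideanSpace ℝ (Fin n))}

theorem IsTestFunction.lqNorm_add_sub {ι : Type*} {s : Finset ι} (hs : s.Nonempty)
    {ψ : ι → EuclideanSpace ℝ (Fin n) → ℝ} (hψ : ∀ i ∈ s, IsTestFunction U (ψ i))
    (hψ0 : ∀ i ∈ s, ∀ x, 0 ≤ ψ i x) {η : ℝ} (hη : 0 < η) :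
    IsTestFunction U fun x => 2 * (lqNorm q s (ψ · x + η) - lqNorm q s fun _ => η) := by
  set T := ⋃ i ∈ s, tsupport (ψ i)
  have hT : IsCompact T := s.isCompact_biUnion fun i hi => (hψ i hi).2.1
  have hsupport : tsupport (fun x => 2 * (lqNorm q s (ψ · x + η) - lqNorm q s fun _ => η)) ⊆ T := by
    refine closure_minimal (fun x hx => ?_) hT.isClosed
    by_contra hxT
    have hzero : ∀ i ∈ s, ψ i x = 0 := fun i hi =>
      image_eq_zero_of_notMem_tsupport fun hxi => hxT (Set.mem_biUnion hi hxi)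
    refine hx ?_
    have hsum : ∑ i ∈ s, (ψ i x + η) ^ q = ∑ _i ∈ s, η ^ q :=
      Finset.sum_congr rfl fun i hi => by rw [hzero i hi, zero_add]
    simp only [lqNorm, hsum, sub_self, mul_zero]
  refine ⟨contDiff_const.mul ((contDiff_lqNorm hs (fun i hi x => ?_) fun i hi => ?_).sub
    contDiff_const), hT.of_isClosed_subset (isClosed_tsupport _) hsupport,
    hsupport.trans (Set.iUnion₂_subset fun i hi => (hψ i hi).2.2)⟩
  · exact add_pos_of_nonneg_of_pos (hψ0 i hi x) hη
  · exact (hψ i hi).1.add contDiff_const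

theorem variationalCapacity_le_sum_lintegral {ι : Type*} {s : Finset ι} (hs : s.Nonempty)
    (hq : 1 ≤ q) {ψ : ι → EuclideanSpace ℝ (Fin n) → ℝ} (hψ : ∀ i ∈ s, IsTestFunction U (ψ i))
    (hψ0 : ∀ i ∈ s, ∀ x, 0 ≤ ψ i x) (hK : ∀ x ∈ K, ∃ i ∈ s, 1 ≤ ψ i x) :
    variationalCapacity q K U ≤
      ENNReal.ofReal (2 ^ q) * ∑ i ∈ s, ∫⁻ x, ‖fderiv ℝ (ψ i) x‖ₑ ^ q := by
  have hq0 : 0 < q := zero_lt_one.trans_le hq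
  have : (0 : ℝ) < s.card := by exact_mod_cast hs.card_pos
  -- `η` is normalised so that the constant family `η` has `ℓ^q` norm `1 / 2`.
  obtain ⟨η, hη, hnorm⟩ : ∃ η : ℝ, 0 < η ∧ lqNorm q s (fun _ => η) = 1 / 2 := by
    refine ⟨((s.card : ℝ) ^ q⁻¹)⁻¹ * (1 / 2), by positivity, ?_⟩
    rw [lqNorm_const hq0.ne' (by positivity), mul_inv_cancel_left₀ (by positivity)]
  set v : EuclideanSpace ℝ (Fin n) → ℝ :=
    fun x => 2 * (lqNorm q s (ψ · x + η) - lqNorm q s fun _ => η)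
  have hpos : ∀ i ∈ s, ∀ x, 0 < ψ i x + η := fun i hi x =>
    add_pos_of_nonneg_of_pos (hψ0 i hi x) hη
  have hge : ∀ x ∈ K, 1 ≤ v x := fun x hx => by
    obtain ⟨i, hi, hix⟩ := hK x hx
    have := le_lqNorm hq0 (fun j hj => (hpos j hj x).le) hi
    simp only [v, hnorm]
    linarith
  have hmeas : ∀ i ∈ s, Measurable fun x => ‖fderiv ℝ (ψ i) x‖ₑ ^ q := fun i hi =>
    ((hψ i hi).1.continuous_fderiv (by simp)).enorm.measurable.pow_const q
  calc variationalCapacity q K U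
      ≤ ∫⁻ x in U, ‖fderiv ℝ v x‖ₑ ^ q :=
        iInf_le_of_le v (iInf₂_le (IsTestFunction.lqNorm_add_sub hs hψ hψ0 hη) hge)
    _ ≤ ∫⁻ x, ENNReal.ofReal (2 ^ q) * ∑ i ∈ s, ‖fderiv ℝ (ψ i) x‖ₑ ^ q :=
        (setLIntegral_le_lintegral _ _).trans <| lintegral_mono fun x =>
          enorm_fderiv_two_mul_lqNorm_add_sub_rpow_le hs hq (fun i hi => hpos i hi x)
            (fun i hi => (hψ i hi).1.differentiable (by simp) x) _
    _ = ENNReal.ofReal (2 ^ q) * ∑ i ∈ s, ∫⁻ x, ‖fderiv ℝ (ψ i) x‖ₑ ^ q := by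
        rw [lintegral_const_mul _ (Finset.measurable_fun_sum s hmeas), lintegral_finsetSum s hmeas]

/-- The standard bump function of the unit ball, transported to `ball w ρ`: it is `1` on that ball
and vanishes outside `ball w (2 * ρ)`. -/
noncomputable def ballBump (w : EuclideanSpace ℝ (Fin n)) (ρ : ℝ) (x : EuclideanSpace ℝ (Fin n)) :
    ℝ :=
  (⟨1, 2, one_pos, one_lt_two⟩ : ContDiffBump (0 : EuclideanSpace ℝ (Fin n))) (ρ⁻¹ • (x - w))

theorem ballBump_nonneg (w : EuclideanSpace ℝ (Fin n)) (ρ : ℝ) (x : EuclideanSpace ℝ (Fin n)) :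
    0 ≤ ballBump w ρ x :=
  ContDiffBump.nonneg _

theorem ballBump_eq_one {w x : EuclideanSpace ℝ (Fin n)} {ρ : ℝ} (hx : x ∈ ball w ρ) :
    ballBump w ρ x = 1 := by
  have hρ : 0 < ρ := pos_of_mem_ball hx
  refine ContDiffBump.one_of_mem_closedBall _ ?_
  rw [mem_closedBall_zero_iff, norm_smul, norm_inv, Real.norm_of_nonneg hρ.le,
    inv_mul_le_iff₀ hρ, mul_one, ← dist_eq_norm]
  exact (mem_ball.1 hx).le

theorem isTestFunction_ballBump {w : EuclideanSpace ℝ (Fin n)} {ρ : ℝ} (hρ : 0 < ρ)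
    (hU : closedBall w (2 * ρ) ⊆ U) : IsTestFunction U (ballBump w ρ) := by
  have hsupport : tsupport (ballBump w ρ) ⊆ closedBall w (2 * ρ) := by
    refine closure_minimal (fun x hx => ?_) isClosed_closedBall
    by_contra hxw
    refine hx (ContDiffBump.zero_of_le_dist _ ?_)
    rw [mem_closedBall, not_le, dist_eq_norm] at hxw
    rw [dist_zero_right, norm_smul, norm_inv, Real.norm_of_nonneg hρ.le, le_inv_mul_iff₀ hρ]
    linarith
  exact ⟨(ContDiffBump.contDiff _).comp (by fun_prop),
    (isCompact_closedBall w _).of_isClosed_subset (isClosed_tsupport _) hsupport,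
    hsupport.trans hU⟩

theorem lintegral_enorm_fderiv_rpow_ne_top {f : EuclideanSpace ℝ (Fin n) → ℝ} (hf : ContDiff ℝ 1 f)
    (hsupp : HasCompactSupport f) (hq : 0 < q) : ∫⁻ x, ‖fderiv ℝ f x‖ₑ ^ q ≠ ⊤ := by
  have hcompact : HasCompactSupport fun x => ‖fderiv ℝ f x‖ ^ q :=
    (hsupp.fderiv ℝ).comp_left (g := fun L => ‖L‖ ^ q) (by simp [hq.ne'])
  have hint : Integrable (fun x => ‖fderiv ℝ f x‖ ^ q) :=
    ((hf.continuous_fderiv one_ne_zero).norm.rpow_const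
      fun _ => Or.inr hq.le).integrable_of_hasCompactSupport hcompact
  simp only [enorm_rpow_eq_ofReal_norm_rpow _ hq.le]
  exact hint.lintegral_lt_top.ne

theorem exists_lintegral_enorm_fderiv_ballBump_eq (n : ℕ) (hq : 0 < q) :
    ∃ C : ℝ≥0, ∀ (w : EuclideanSpace ℝ (Fin n)) {ρ : ℝ}, 0 < ρ →
      ∫⁻ x, ‖fderiv ℝ (ballBump w ρ) x‖ₑ ^ q = C * ENNReal.ofReal (ρ ^ (n - q)) := by
  let b : ContDiffBump (0 : EuclideanSpace ℝ (Fin n)) := ⟨1, 2, one_pos, one_lt_two⟩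
  lift ∫⁻ x, ‖fderiv ℝ b x‖ₑ ^ q to ℝ≥0 using
    lintegral_enorm_fderiv_rpow_ne_top b.contDiff b.hasCompactSupport hq with C hC
  refine ⟨C, fun w ρ hρ => ?_⟩
  have hscale := lintegral_enorm_fderiv_comp_inv_smul_sub volume b hq.le w hρ
  rw [finrank_euclideanSpace_fin] at hscale
  rw [hC, mul_comm, ← hscale]
  rfl

theorem exists_variationalCapacity_le_sum_rpow (n : ℕ) (hq : 1 ≤ q) :
    ∃ C : ℝ≥0, ∀ (K U : Set (EuclideanSpace ℝ (Fin n)))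
      (s : Finset (EuclideanSpace ℝ (Fin n))) (ρ : EuclideanSpace ℝ (Fin n) → ℝ), s.Nonempty →
      (∀ w ∈ s, 0 < ρ w) → K ⊆ ⋃ w ∈ s, ball w (ρ w) →
      (∀ w ∈ s, closedBall w (2 * ρ w) ⊆ U) →
      variationalCapacity q K U ≤ C * ∑ w ∈ s, ENNReal.ofReal (ρ w ^ (n - q)) := by
  obtain ⟨C, hC⟩ := exists_lintegral_enorm_fderiv_ballBump_eq n (zero_lt_one.trans_le hq)
  refine ⟨(2 ^ q : ℝ).toNNReal * C, fun K U s ρ hs hρ hK hU => ?_⟩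
  have hcover : ∀ x ∈ K, ∃ w ∈ s, 1 ≤ ballBump w (ρ w) x := fun x hx => by
    obtain ⟨w, hw, hxw⟩ := Set.mem_iUnion₂.1 (hK hx)
    exact ⟨w, hw, (ballBump_eq_one hxw).ge⟩
  calc variationalCapacity q K U
      ≤ ENNReal.ofReal (2 ^ q) * ∑ w ∈ s, ∫⁻ x, ‖fderiv ℝ (ballBump w (ρ w)) x‖ₑ ^ q :=
        variationalCapacity_le_sum_lintegral hs hq
          (fun w hw => isTestFunction_ballBump (hρ w hw) (hU w hw))
          (fun w _ => ballBump_nonneg w (ρ w)) hcover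
    _ = ENNReal.ofReal (2 ^ q) * ∑ w ∈ s, C * ENNReal.ofReal (ρ w ^ (n - q)) := by
        rw [Finset.sum_congr rfl fun w hw => hC w (hρ w hw)]
    _ = _ := by rw [← Finset.mul_sum, ENNReal.coe_mul, mul_assoc]; rfl

end Capacity

section FatMass

theorem exists_finset_pairwiseDisjoint_closedBall_cover {X : Type*} [PseudoMetricSpace X]
    {K : Set X} (hK : IsCompact K) {r : X → ℝ} {R : ℝ} (hr : ∀ w ∈ K, r w ∈ Set.Ioc 0 R) :
    ∃ s : Finset X, ↑s ⊆ K ∧ (s : Set X).PairwiseDisjoint (fun w => closedBall w (r w)) ∧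
      K ⊆ ⋃ w ∈ s, ball w (6 * r w) := by
  obtain ⟨v, hvK, hdisj, hcover⟩ :=
    Vitali.exists_disjoint_subfamily_covering_enlargement_closedBall K id r R
      (fun w hw => (hr w hw).2) 5 (by norm_num)
  have hopen : K ⊆ ⋃ w ∈ v, ball w (6 * r w) := fun w hw => by
    obtain ⟨z, hz, hwz⟩ := hcover w hw
    have hrz := (hr z (hvK hz)).1
    exact Set.mem_biUnion hz (closedBall_subset_ball (by linarith)
      (hwz (mem_closedBall_self (hr w hw).1.le)))
  obtain ⟨s, hsv, hfin, hs⟩ := hK.elim_finite_subcover_image (fun _ _ => isOpen_ball) hopen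
  lift s to Finset X using hfin
  exact ⟨s, hsv.trans hvK, hdisj.subset hsv, by simpa only [Finset.mem_coe] using hs⟩

theorem min_rpow_mul_rpow_le {a b D r : ℝ} (e : ℝ) (ha : 0 < a) (hD : 0 < D)
    (har : a * D ≤ r) (hrb : r ≤ b * D) : min (a ^ e) (b ^ e) * D ^ e ≤ r ^ e := by
  have hr : 0 < r := lt_of_lt_of_le (by positivity) har
  have hb : 0 < b := pos_of_mul_pos_left (hr.trans_le hrb) hD.le
  rcases le_total 0 e with he | he
  · calc min (a ^ e) (b ^ e) * D ^ e ≤ a ^ e * D ^ e := by gcongr; exact min_le_left _ _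
      _ = (a * D) ^ e := (Real.mul_rpow ha.le hD.le).symm
      _ ≤ r ^ e := by gcongr
  · calc min (a ^ e) (b ^ e) * D ^ e ≤ b ^ e * D ^ e := by gcongr; exact min_le_right _ _
      _ = (b * D) ^ e := (Real.mul_rpow hb.le hD.le).symm
      _ ≤ r ^ e := Real.rpow_le_rpow_of_nonpos hr hrb he

variable {n : ℕ} {q : ℝ} {F : Set (EuclideanSpace ℝ (Fin n))}

theorem UniformlyFat.exists_rpow_le_sum_rpow (hfat : UniformlyFat q F) (hq : 1 ≤ q) :
    ∃ c : ℝ, 0 < c ∧ ∀ x ∈ F, ∀ r : ℝ, 0 < r → ∀ (s : Finset (EuclideanSpace ℝ (Fin n)))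
      (ρ : EuclideanSpace ℝ (Fin n) → ℝ), (∀ w ∈ s, 0 < ρ w) →
      F ∩ closedBall x r ⊆ ⋃ w ∈ s, ball w (ρ w) →
      (∀ w ∈ s, closedBall w (2 * ρ w) ⊆ ball x (2 * r)) →
      ENNReal.ofReal (c * r ^ (n - q)) ≤ ∑ w ∈ s, ENNReal.ofReal (ρ w ^ (n - q)) := by
  obtain ⟨c, hc, hfat⟩ := hfat
  obtain ⟨C, hcap⟩ := exists_variationalCapacity_le_sum_rpow n hq
  refine ⟨c / (C + 1), by positivity, fun x hx r hr s ρ hρ hcover hsub => ?_⟩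
  have hs : s.Nonempty := by
    obtain ⟨w, hw, -⟩ := Set.mem_iUnion₂.1 (hcover ⟨hx, mem_closedBall_self hr.le⟩)
    exact ⟨w, hw⟩
  rw [div_mul_eq_mul_div, ENNReal.ofReal_div_of_pos (by positivity)]
  refine ENNReal.div_le_of_le_mul' (((hfat x hx r hr).trans
    (hcap _ _ s ρ hs hρ hcover hsub)).trans ?_)
  gcongr
  rw [← ENNReal.ofReal_coe_nnreal]
  gcongr
  linarith

theorem UniformlyFat.exists_rpow_le_measure_ball_of_small_radius (hfat : UniformlyFat q F)
    (hF : IsClosed F) (hq : 1 ≤ q) :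
    ∃ c : ℝ, 0 < c ∧ ∀ (μ : Measure (EuclideanSpace ℝ (Fin n))) (A : ℝ≥0∞), ∀ x ∈ F,
      ∀ D : ℝ, 0 < D → ∀ ρ : EuclideanSpace ℝ (Fin n) → ℝ,
      (∀ w ∈ F ∩ closedBall x D, 0 < ρ w ∧ 12 * ρ w < D ∧
        A * ENNReal.ofReal (ρ w ^ (n - q)) ≤ μ (ball w (ρ w))) →
      A * ENNReal.ofReal (c * D ^ (n - q)) ≤ μ (ball x (4 * D)) := by
  obtain ⟨c, hc, hcontent⟩ := hfat.exists_rpow_le_sum_rpow hq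
  refine ⟨c / 6 ^ ((n : ℝ) - q), by positivity, fun μ A x hx D hD ρ hρ => ?_⟩
  set K := F ∩ closedBall x D
  obtain ⟨s, hsK, hdisj, hcover⟩ := exists_finset_pairwiseDisjoint_closedBall_cover
    ((isCompact_closedBall x D).inter_left hF) fun w hw =>
      (⟨(hρ w hw).1, by linarith [(hρ w hw).1, (hρ w hw).2.1]⟩ : ρ w ∈ Set.Ioc 0 D)
  have hsum : ENNReal.ofReal (c / 6 ^ ((n : ℝ) - q) * D ^ (n - q)) ≤
      ∑ w ∈ s, ENNReal.ofReal (ρ w ^ (n - q)) := by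
    have hle := hcontent x hx D hD s (fun w => 6 * ρ w)
      (fun w hw => mul_pos (by norm_num) (hρ w (hsK hw)).1) hcover fun w hw =>
        closedBall_subset_ball' (by linarith [(hρ w (hsK hw)).2.1, mem_closedBall.1 (hsK hw).2])
    have hscale : ∀ w ∈ s, ENNReal.ofReal ((6 * ρ w) ^ (n - q)) =
        ENNReal.ofReal (6 ^ (n - q)) * ENNReal.ofReal (ρ w ^ (n - q)) := fun w hw => by
      rw [Real.mul_rpow (by norm_num) (hρ w (hsK hw)).1.le, ENNReal.ofReal_mul (by positivity)]
    rw [Finset.sum_congr rfl hscale, ← Finset.mul_sum] at hle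
    rw [div_mul_eq_mul_div, ENNReal.ofReal_div_of_pos (by positivity)]
    exact ENNReal.div_le_of_le_mul' hle
  calc A * ENNReal.ofReal (c / 6 ^ ((n : ℝ) - q) * D ^ (n - q))
      ≤ ∑ w ∈ s, A * ENNReal.ofReal (ρ w ^ (n - q)) := by
        rw [← Finset.mul_sum]
        gcongr
    _ ≤ ∑ w ∈ s, μ (ball w (ρ w)) := Finset.sum_le_sum fun w hw => (hρ w (hsK hw)).2.2
    _ = μ (⋃ w ∈ s, ball w (ρ w)) :=
        (measure_biUnion_finset (fun w hw z hz hwz => (hdisj hw hz hwz).mono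
          ball_subset_closedBall ball_subset_closedBall) fun _ _ => measurableSet_ball).symm
    _ ≤ μ (ball x (4 * D)) := measure_mono <| Set.iUnion₂_subset fun w hw => ball_subset_ball' <| by
        linarith [(hρ w (hsK hw)).2.1, mem_closedBall.1 (hsK hw).2]

theorem UniformlyFat.exists_rpow_le_measure_ball (hfat : UniformlyFat q F) (hF : IsClosed F)
    (hq : 1 ≤ q) :
    ∃ κ : ℝ, 0 < κ ∧ ∀ (μ : Measure (EuclideanSpace ℝ (Fin n))) (A : ℝ≥0∞), ∀ x ∈ F,
      ∀ D : ℝ, 0 < D → (∀ w ∈ F ∩ closedBall x D, ∃ ρ ∈ Set.Ioc 0 (3 * D),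
        A * ENNReal.ofReal (ρ ^ (n - q)) ≤ μ (ball w ρ)) →
      A * ENNReal.ofReal (κ * D ^ (n - q)) ≤ μ (ball x (4 * D)) := by
  set e : ℝ := n - q
  set m : ℝ := min ((1 / 12) ^ e) (3 ^ e)
  have : 0 < m := by positivity
  obtain ⟨c, hc, hsmall⟩ := hfat.exists_rpow_le_measure_ball_of_small_radius hF hq
  refine ⟨min c m, by positivity,
    fun μ A x hx D hD hball => ?_⟩
  choose! ρ hρ hμ using hball
  by_cases hlarge : ∃ w ∈ F ∩ closedBall x D, D ≤ 12 * ρ w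
  · obtain ⟨w, hw, hwρ⟩ := hlarge
    calc A * ENNReal.ofReal (min c m * D ^ e)
        ≤ A * ENNReal.ofReal (m * D ^ e) := by
          gcongr
          exact min_le_right _ _
      _ ≤ A * ENNReal.ofReal (ρ w ^ e) := by
          gcongr
          exact min_rpow_mul_rpow_le e (by norm_num) hD (by linarith) (hρ w hw).2
      _ ≤ μ (ball w (ρ w)) := hμ w hw
      _ ≤ μ (ball x (4 * D)) := measure_mono <| ball_subset_ball' <| by
          linarith [(hρ w hw).2, mem_closedBall.1 hw.2]
  · push Not at hlarge
    calc A * ENNReal.ofReal (min c m * D ^ e)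
        ≤ A * ENNReal.ofReal (c * D ^ e) := by
          gcongr
          exact min_le_left _ _
      _ ≤ μ (ball x (4 * D)) :=
          hsmall μ A x hx D hD ρ fun w hw => ⟨(hρ w hw).1, hlarge w hw, hμ w hw⟩

end FatMass

section LocalEstimate

theorem lintegral_ball_le_lintegral_mul_infEDist_rpow {X : Type*} [PseudoMetricSpace X]
    [MeasurableSpace X] [OpensMeasurableSpace X] (μ : Measure X) {F : Set X} (g : X → ℝ≥0∞)
    {s : ℝ} (hs : 0 ≤ s) {w : X} (hw : w ∈ F) {ρ : ℝ} (hρ : 0 < ρ) :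
    ∫⁻ y in ball w ρ, g y ∂μ ≤
      ENNReal.ofReal (ρ ^ s) * ∫⁻ y in ball w ρ, g y * infEDist y F ^ (-s) ∂μ := by
  rw [← lintegral_const_mul' _ _ ENNReal.ofReal_ne_top]
  refine setLIntegral_mono' measurableSet_ball fun y hy => ?_
  have hdist : infEDist y F ≤ ENNReal.ofReal ρ :=
    (infEDist_le_edist_of_mem hw).trans ((edist_lt_ofReal.2 hy).le)
  have hweight : 1 ≤ ENNReal.ofReal (ρ ^ s) * infEDist y F ^ (-s) := by
    rw [ENNReal.rpow_neg, ← div_eq_mul_inv, ENNReal.le_div_iff_mul_le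
      (Or.inr (ENNReal.ofReal_pos.2 (by positivity)).ne') (Or.inr ENNReal.ofReal_ne_top),
      one_mul, ← ENNReal.ofReal_rpow_of_pos hρ]
    exact ENNReal.rpow_le_rpow hdist hs
  calc g y ≤ g y * (ENNReal.ofReal (ρ ^ s) * infEDist y F ^ (-s)) :=
        le_mul_of_one_le_right' hweight
    _ = _ := mul_left_comm _ _ _

theorem exists_radius_le_lintegral_ball_fderiv_mul_infEDist {E : Type*} [NormedAddCommGroup E]
    [NormedSpace ℝ E] [FiniteDimensional ℝ E] [MeasurableSpace E] [BorelSpace E] (μ : Measure E)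
    [μ.IsAddHaarMeasure] {u : E → ℝ} (hu : ContDiff ℝ 1 u) {F : Set E} {w : E} (hw : w ∈ F)
    (huw : u w = 0) {q a R δ : ℝ} (hq : 1 ≤ q) (ha : 0 ≤ a) (hR : 0 < R) (hδ : 0 < δ)
    (hlt : ENNReal.ofReal (a * R ^ (finrank ℝ E + δ) / δ) < ∫⁻ y in ball w R, ‖u y‖ₑ ∂μ) :
    ∃ ρ ∈ Set.Ioc 0 R, ENNReal.ofReal a * ENNReal.ofReal (ρ ^ (finrank ℝ E - q)) ≤
      ∫⁻ y in ball w ρ, ‖fderiv ℝ u y‖ₑ * infEDist y F ^ (1 - (q + δ)) ∂μ := by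
  obtain ⟨ρ, hρ, hgrad⟩ := exists_radius_le_lintegral_ball_fderiv μ hu (w := w) ha hR hδ
    (by simpa only [huw, sub_zero] using hlt)
  have hρ0 : 0 < ρ := hρ.1
  have hpow : a * ρ ^ ((finrank ℝ E : ℝ) - 1 + δ) =
      ρ ^ (q + δ - 1) * (a * ρ ^ (finrank ℝ E - q)) := by
    rw [mul_left_comm, ← Real.rpow_add hρ0]
    ring_nf
  have hweight := hgrad.trans (lintegral_ball_le_lintegral_mul_infEDist_rpow μ
    (fun y => ‖fderiv ℝ u y‖ₑ) (s := q + δ - 1) (by linarith) hw hρ0)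
  rw [hpow, ENNReal.ofReal_mul (by positivity), neg_sub,
    ENNReal.mul_le_mul_iff_right (by simpa using by positivity) ENNReal.ofReal_ne_top] at hweight
  exact ⟨ρ, hρ, by rwa [← ENNReal.ofReal_mul ha]⟩

variable {n : ℕ} {q : ℝ} {F : Set (EuclideanSpace ℝ (Fin n))}

theorem UniformlyFat.exists_rpow_le_lintegral_ball_of_lt (hfat : UniformlyFat q F)
    (hF : IsClosed F) (hq : 1 ≤ q) {δ : ℝ} (hδ : 0 < δ) :
    ∃ κ : ℝ, 0 < κ ∧ ∀ u : EuclideanSpace ℝ (Fin n) → ℝ, ContDiff ℝ 1 u → (∀ w ∈ F, u w = 0) →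
      ∀ x, 0 < infDist x F → ∀ a : ℝ, 0 ≤ a →
      ENNReal.ofReal (a * (3 * infDist x F) ^ (n + δ) / δ) <
        ∫⁻ y in ball x (infDist x F), ‖u y‖ₑ →
      ENNReal.ofReal a * ENNReal.ofReal (κ * infDist x F ^ (n - q)) ≤
        ∫⁻ y in ball x (5 * infDist x F), ‖fderiv ℝ u y‖ₑ * infEDist y F ^ (1 - (q + δ)) := by
  obtain ⟨κ, hκ, hmass⟩ := hfat.exists_rpow_le_measure_ball hF hq
  refine ⟨κ, hκ, fun u hu hu0 x hx a ha hlt => ?_⟩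
  set D := infDist x F
  have hne : F.Nonempty := by
    by_contra! hempty
    simp [D, hempty] at hx
  obtain ⟨x₀, hx₀, hxx₀⟩ := hF.exists_infDist_eq_dist hne x
  set μ := volume.withDensity fun y => ‖fderiv ℝ u y‖ₑ * infEDist y F ^ (1 - (q + δ))
  have hball : ∀ w ∈ F ∩ closedBall x₀ D, ∃ ρ ∈ Set.Ioc 0 (3 * D),
      ENNReal.ofReal a * ENNReal.ofReal (ρ ^ (n - q)) ≤ μ (ball w ρ) := by
    intro w hw
    have hsub : ball x D ⊆ ball w (3 * D) := ball_subset_ball' <| by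
      have := dist_triangle_right x w x₀
      rw [← hxx₀] at this
      linarith [mem_closedBall.1 hw.2]
    obtain ⟨ρ, hρ, hle⟩ := exists_radius_le_lintegral_ball_fderiv_mul_infEDist volume hu hw.1
      (hu0 w hw.1) hq ha (R := 3 * D) (by positivity) hδ (by
        rw [finrank_euclideanSpace_fin]
        exact hlt.trans_le (lintegral_mono_set hsub))
    rw [finrank_euclideanSpace_fin, ← withDensity_apply _ measurableSet_ball] at hle
    exact ⟨ρ, hρ, hle⟩
  calc ENNReal.ofReal a * ENNReal.ofReal (κ * D ^ (n - q))
      ≤ μ (ball x₀ (4 * D)) := hmass μ _ x₀ hx₀ D hx hball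
    _ ≤ μ (ball x (5 * D)) :=
        measure_mono (ball_subset_ball' (by rw [dist_comm, ← hxx₀]; linarith))
    _ = _ := withDensity_apply _ measurableSet_ball

theorem UniformlyFat.exists_lintegral_ball_enorm_le (hfat : UniformlyFat q F) (hF : IsClosed F)
    (hq : 1 ≤ q) {δ : ℝ} (hδ : 0 < δ) :
    ∃ C : ℝ, 0 < C ∧ ∀ u : EuclideanSpace ℝ (Fin n) → ℝ, ContDiff ℝ 1 u → (∀ w ∈ F, u w = 0) →
      ∀ x, 0 < infDist x F → ∫⁻ y in ball x (infDist x F), ‖u y‖ₑ ≤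
        ENNReal.ofReal (C * infDist x F ^ (q + δ)) * ∫⁻ y in ball x (5 * infDist x F),
          ‖fderiv ℝ u y‖ₑ * infEDist y F ^ (1 - (q + δ)) := by
  obtain ⟨κ, hκ, henergy⟩ := hfat.exists_rpow_le_lintegral_ball_of_lt hF hq hδ
  refine ⟨3 ^ (n + δ) / (δ * κ), by positivity, fun u hu hu0 x hx => ?_⟩
  set D := infDist x F
  refine ENNReal.le_of_forall_nnreal_lt fun b hb => ?_
  set a : ℝ := b * δ / (3 * D) ^ (n + δ)
  have hab : ENNReal.ofReal (a * (3 * D) ^ (n + δ) / δ) = b := by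
    simp only [a]
    rw [div_mul_cancel₀ _ (by positivity), mul_div_cancel_right₀ _ hδ.ne',
      ENNReal.ofReal_coe_nnreal]
  have hfactor : (b : ℝ) = 3 ^ (n + δ) / (δ * κ) * D ^ (q + δ) * (a * (κ * D ^ (n - q))) := by
    have hpow : D ^ (n + δ) = D ^ (q + δ) * D ^ (n - q) := by
      rw [← Real.rpow_add hx]
      ring_nf
    simp only [a]
    rw [Real.mul_rpow (by norm_num) hx.le, hpow]
    field_simp
  calc (b : ℝ≥0∞) = ENNReal.ofReal (3 ^ (n + δ) / (δ * κ) * D ^ (q + δ)) *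
        (ENNReal.ofReal a * ENNReal.ofReal (κ * D ^ (n - q))) := by
        rw [← ENNReal.ofReal_mul (by positivity), ← ENNReal.ofReal_mul (by positivity), ← hfactor,
          ENNReal.ofReal_coe_nnreal]
    _ ≤ _ := by
        gcongr
        exact henergy u hu hu0 x hx a (by positivity) (hab.trans_lt hb)

end LocalEstimate

section Averaging

theorem lintegral_mul_lintegral_ball {X : Type*} [PseudoMetricSpace X] [SecondCountableTopology X]
    [MeasurableSpace X] [OpensMeasurableSpace X] (μ : Measure X) [SFinite μ] {w f : X → ℝ≥0∞}
    (hw : Measurable w) (hf : Measurable f) {r : X → ℝ} (hr : Measurable r) :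
    ∫⁻ x, w x * ∫⁻ y in ball x (r x), f y ∂μ ∂μ =
      ∫⁻ y, f y * ∫⁻ x in {x | dist y x < r x}, w x ∂μ ∂μ := by
  set S : Set (X × X) := {z | dist z.2 z.1 < r z.1}
  have hS : MeasurableSet S :=
    measurableSet_lt (measurable_snd.dist measurable_fst) (hr.comp measurable_fst)
  have hk : Measurable (Function.uncurry fun x y => S.indicator (fun z => w z.1 * f z.2) (x, y)) :=
    ((hw.comp measurable_fst).mul (hf.comp measurable_snd)).indicator hS
  calc ∫⁻ x, w x * ∫⁻ y in ball x (r x), f y ∂μ ∂μ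
      = ∫⁻ x, ∫⁻ y, S.indicator (fun z => w z.1 * f z.2) (x, y) ∂μ ∂μ := by
        refine lintegral_congr fun x => ?_
        rw [← lintegral_const_mul _ hf, ← lintegral_indicator measurableSet_ball]
        exact lintegral_congr fun y => Set.indicator_eq_indicator Iff.rfl rfl
    _ = ∫⁻ y, ∫⁻ x, S.indicator (fun z => w z.1 * f z.2) (x, y) ∂μ ∂μ :=
        lintegral_lintegral_swap hk.aemeasurable
    _ = _ := by
        refine lintegral_congr fun y => ?_
        rw [← lintegral_const_mul _ hw,
          ← lintegral_indicator (measurableSet_lt (measurable_const.dist measurable_id') hr)]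
        exact lintegral_congr fun x => Set.indicator_eq_indicator Iff.rfl (mul_comm _ _)

theorem infEDist_rpow_eq_ofReal {X : Type*} [PseudoMetricSpace X] {F : Set X} {x : X}
    (hx : 0 < infDist x F) (s : ℝ) : infEDist x F ^ s = ENNReal.ofReal (infDist x F ^ s) := by
  rw [← ENNReal.ofReal_rpow_of_pos hx, infDist, ENNReal.ofReal_toReal]
  rintro htop
  simp [infDist, htop] at hx

theorem infEDist_rpow_neg_le {X : Type*} [PseudoMetricSpace X] {F : Set X} {x y : X} {r : ℝ}
    (hr : 0 ≤ r) (hy : 0 < infDist y F) (hxy : dist y x < 5 * infDist x F) :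
    infEDist x F ^ (-r) ≤
      ENNReal.ofReal (11 ^ r) * ENNReal.ofReal ((infDist y F + dist x y) ^ (-r)) := by
  have hyx := infDist_le_infDist_add_dist (s := F) (x := y) (y := x)
  have hx : 0 < infDist x F := by linarith [dist_nonneg (x := y) (y := x)]
  have hle : (infDist y F + dist x y) / 11 ≤ infDist x F := by
    rw [dist_comm]
    linarith
  rw [infEDist_rpow_eq_ofReal hx, ← ENNReal.ofReal_mul (by positivity), mul_comm, ← div_inv_eq_mul,
    ← Real.rpow_neg (by norm_num), ← Real.div_rpow (by positivity) (by norm_num)]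
  exact ENNReal.ofReal_le_ofReal <|
    Real.rpow_le_rpow_of_nonpos (by positivity) hle (neg_nonpos.2 hr)

theorem rpow_neg_add_of_nonneg {a b : ℝ} (ha : 0 ≤ a) (hb : 0 ≤ b) (x : ℝ≥0∞) :
    x ^ (-(a + b)) = x ^ (-a) * x ^ (-b) := by
  rw [ENNReal.rpow_neg, ENNReal.rpow_neg, ENNReal.rpow_neg, ← ENNReal.inv_rpow,
    ← ENNReal.inv_rpow, ← ENNReal.inv_rpow, ENNReal.rpow_add_of_nonneg _ _ ha hb]

variable {E : Type*} [NormedAddCommGroup E] [NormedSpace ℝ E] [FiniteDimensional ℝ E]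
  [MeasurableSpace E] [BorelSpace E] (μ : Measure E) [μ.IsAddHaarMeasure] (F : Set E)

theorem exists_mul_infEDist_rpow_le_lintegral {q : ℝ} (hq : 0 ≤ q) :
    ∃ c : ℝ, 0 < c ∧ ∀ y, 0 < infDist y F → ENNReal.ofReal c * infEDist y F ^ (-q) ≤
      ∫⁻ x in {x | dist y x < infDist x F}, infEDist x F ^ (-q - finrank ℝ E) ∂μ := by
  set d : ℕ := finrank ℝ E
  set v : ℝ := μ.real (ball 0 1)
  have hv : 0 < v :=
    ENNReal.toReal_pos (measure_ball_pos μ 0 one_pos).ne' measure_ball_lt_top.ne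
  refine ⟨(3 / 2) ^ (-q - d) * (1 / 2) ^ d * v, by positivity, fun y hy => ?_⟩
  set D := infDist y F
  have hdist (x : E) (hx : x ∈ ball y (D / 2)) : D / 2 < infDist x F ∧ infDist x F ≤ 3 / 2 * D := by
    have hxy := infDist_le_infDist_add_dist (s := F) (x := x) (y := y)
    have hyx := infDist_le_infDist_add_dist (s := F) (x := y) (y := x)
    rw [dist_comm] at hyx
    constructor <;> linarith [mem_ball.1 hx]
  have hsub : ball y (D / 2) ⊆ {x | dist y x < infDist x F} := fun x hx =>
    (mem_ball'.1 hx).trans (hdist x hx).1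
  have hvol : μ (ball y (D / 2)) = ENNReal.ofReal ((D / 2) ^ d * v) := by
    rw [Measure.addHaar_ball_of_pos μ y (by positivity), ENNReal.ofReal_mul (by positivity),
      ofReal_measureReal measure_ball_lt_top.ne]
  have hweight : infEDist y F ^ (-q) = ENNReal.ofReal (D ^ (-q)) := infEDist_rpow_eq_ofReal hy _
  calc ENNReal.ofReal ((3 / 2) ^ (-q - d) * (1 / 2) ^ d * v) * infEDist y F ^ (-q)
      = ENNReal.ofReal ((3 / 2 * D) ^ (-q - d)) * μ (ball y (D / 2)) := by
        rw [hweight, hvol, ← ENNReal.ofReal_mul (by positivity),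
          ← ENNReal.ofReal_mul (by positivity), Real.mul_rpow (by norm_num) hy.le,
          Real.rpow_sub_natCast hy.ne', div_pow, div_pow, one_pow]
        congr 1
        field_simp
    _ = ∫⁻ _ in ball y (D / 2), ENNReal.ofReal ((3 / 2 * D) ^ (-q - d)) ∂μ := by
        rw [setLIntegral_const]
    _ ≤ ∫⁻ x in ball y (D / 2), infEDist x F ^ (-q - d) ∂μ := by
        refine setLIntegral_mono' measurableSet_ball fun x hx => ?_
        obtain ⟨hlow, hupp⟩ := hdist x hx
        have hx0 : 0 < infDist x F := by linarith
        rw [infEDist_rpow_eq_ofReal hx0]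
        exact ENNReal.ofReal_le_ofReal <|
          Real.rpow_le_rpow_of_nonpos hx0 hupp (by linarith [d.cast_nonneg (α := ℝ)])
    _ ≤ _ := lintegral_mono_set hsub

variable {F} in
theorem lintegral_infEDist_rpow_le {r : ℝ} (hr : 0 ≤ r) {y : E} (hy : 0 < infDist y F) :
    ∫⁻ x in {x | dist y x < 5 * infDist x F}, infEDist x F ^ (-r) ∂μ ≤
      ENNReal.ofReal (11 ^ r) *
        (infEDist y F ^ (finrank ℝ E - r) * ∫⁻ z, ENNReal.ofReal ((1 + ‖z‖) ^ (-r)) ∂μ) := by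
  have hset : MeasurableSet {x | dist y x < 5 * infDist x F} :=
    (isOpen_lt (by fun_prop) (by fun_prop)).measurableSet
  calc ∫⁻ x in {x | dist y x < 5 * infDist x F}, infEDist x F ^ (-r) ∂μ
      ≤ ∫⁻ x in {x | dist y x < 5 * infDist x F},
          ENNReal.ofReal (11 ^ r) * ENNReal.ofReal ((infDist y F + dist x y) ^ (-r)) ∂μ :=
        setLIntegral_mono' hset fun x hx => infEDist_rpow_neg_le hr hy hx
    _ ≤ ∫⁻ x, ENNReal.ofReal (11 ^ r) * ENNReal.ofReal ((infDist y F + dist x y) ^ (-r)) ∂μ :=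
        setLIntegral_le_lintegral _ _
    _ = _ := by
        rw [lintegral_const_mul' _ _ ENNReal.ofReal_ne_top, lintegral_add_dist_rpow_neg μ r y hy,
          infEDist_rpow_eq_ofReal hy]

theorem exists_lintegral_infEDist_rpow_le {ε : ℝ} (hε : 0 < ε) :
    ∃ C : ℝ, 0 < C ∧ ∀ y,
      ∫⁻ x in {x | dist y x < 5 * infDist x F}, infEDist x F ^ (-(finrank ℝ E + ε)) ∂μ ≤
        ENNReal.ofReal C * infEDist y F ^ (-ε) := by
  set r : ℝ := finrank ℝ E + ε
  have hfin : ∫⁻ z, ENNReal.ofReal ((1 + ‖z‖) ^ (-r)) ∂μ < ⊤ :=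
    finite_integral_one_add_norm (lt_add_of_pos_right _ hε)
  set I := ∫⁻ z, ENNReal.ofReal ((1 + ‖z‖) ^ (-r)) ∂μ
  refine ⟨11 ^ r * (I.toReal + 1), by positivity, fun y => ?_⟩
  rcases (infDist_nonneg (x := y) (s := F)).eq_or_lt with hy | hy
  · rcases F.eq_empty_or_nonempty with rfl | hne
    · simp [not_lt.2 dist_nonneg]
    · have hzero : infEDist y F = 0 := by
        rw [← ENNReal.ofReal_toReal (infEDist_ne_top hne), ← infDist, ← hy, ENNReal.ofReal_zero]
      simp [hzero, ENNReal.zero_rpow_of_neg (neg_lt_zero.2 hε), ENNReal.mul_top,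
        show 0 < 11 ^ r * (I.toReal + 1) by positivity]
  calc ∫⁻ x in {x | dist y x < 5 * infDist x F}, infEDist x F ^ (-r) ∂μ
      ≤ ENNReal.ofReal (11 ^ r) * (infEDist y F ^ (-ε) * I) := by
        simpa only [r, sub_add_cancel_left] using
          lintegral_infEDist_rpow_le μ (r := r) (by positivity) hy
    _ ≤ ENNReal.ofReal (11 ^ r) * (infEDist y F ^ (-ε) * ENNReal.ofReal (I.toReal + 1)) := by
        gcongr
        rw [← ENNReal.ofReal_toReal hfin.ne]
        gcongr
        simp
    _ = _ := by
        rw [ENNReal.ofReal_mul (by positivity)]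
        ring

theorem exists_lintegral_infEDist_rpow_mul_lintegral_ball_le {q ε : ℝ} (hq : 0 ≤ q)
    (hε : 0 < ε) :
    ∃ C : ℝ, 0 < C ∧ ∀ f : E → ℝ≥0∞, Measurable f →
      ∫⁻ x, infEDist x F ^ (-(finrank ℝ E + ε)) *
          ∫⁻ y in ball x (5 * infDist x F), f y * infEDist y F ^ (-q) ∂μ ∂μ ≤
        ENNReal.ofReal C * ∫⁻ y, f y * infEDist y F ^ (-(q + ε)) ∂μ := by
  obtain ⟨C, hC, hupp⟩ := exists_lintegral_infEDist_rpow_le μ F hε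
  refine ⟨C, hC, fun f hf => ?_⟩
  rw [lintegral_mul_lintegral_ball μ (measurable_infEDist.pow_const _)
    (f := fun y => f y * infEDist y F ^ (-q)) (hf.mul (measurable_infEDist.pow_const _))
    (measurable_infDist.const_mul 5),
    ← lintegral_const_mul' _ _ ENNReal.ofReal_ne_top]
  refine lintegral_mono fun y => ?_
  calc f y * infEDist y F ^ (-q) *
        ∫⁻ x in {x | dist y x < 5 * infDist x F}, infEDist x F ^ (-(finrank ℝ E + ε)) ∂μ
      ≤ f y * infEDist y F ^ (-q) * (ENNReal.ofReal C * infEDist y F ^ (-ε)) := by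
        gcongr
        exact hupp y
    _ = _ := by
        rw [rpow_neg_add_of_nonneg hq hε.le]
        ring

variable {F}

theorem exists_mul_lintegral_mul_infEDist_rpow_le (hF : IsClosed F) (hne : F.Nonempty) {q : ℝ}
    (hq : 0 ≤ q) :
    ∃ c : ℝ, 0 < c ∧ ∀ f : E → ℝ≥0∞, Measurable f → (∀ w ∈ F, f w = 0) →
      ENNReal.ofReal c * ∫⁻ y, f y * infEDist y F ^ (-q) ∂μ ≤
        ∫⁻ x, infEDist x F ^ (-q - finrank ℝ E) * ∫⁻ y in ball x (infDist x F), f y ∂μ ∂μ := by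
  obtain ⟨c, hc, hlow⟩ := exists_mul_infEDist_rpow_le_lintegral μ F hq
  refine ⟨c, hc, fun f hf hf0 => ?_⟩
  rw [lintegral_mul_lintegral_ball μ (measurable_infEDist.pow_const _) hf measurable_infDist,
    ← lintegral_const_mul' _ _ ENNReal.ofReal_ne_top]
  refine lintegral_mono fun y => ?_
  by_cases hy : y ∈ F
  · simp [hf0 y hy]
  · rw [mul_left_comm]
    gcongr
    exact hlow y ((hF.notMem_iff_infDist_pos hne).1 hy)

end Averaging

section HardyOne

variable {n : ℕ} {q : ℝ} {F : Set (EuclideanSpace ℝ (Fin n))}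

theorem UniformlyFat.exists_lintegral_mul_infEDist_rpow_le (hfat : UniformlyFat q F)
    (hF : IsClosed F) (hne : F.Nonempty) (hq : 1 ≤ q) {r : ℝ} (hr : q < r) :
    ∃ C : ℝ, 0 < C ∧ ∀ u : EuclideanSpace ℝ (Fin n) → ℝ, ContDiff ℝ 1 u → (∀ w ∈ F, u w = 0) →
      ∫⁻ x, ‖u x‖ₑ * infEDist x F ^ (-r) ≤
        ENNReal.ofReal C * ∫⁻ x, ‖fderiv ℝ u x‖ₑ * infEDist x F ^ (1 - r) := by
  obtain ⟨ε, hε, rfl⟩ : ∃ ε, 0 < ε ∧ r = q + ε + ε :=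
    ⟨(r - q) / 2, by linarith, by ring⟩
  obtain ⟨C₁, hC₁, hlocal⟩ := hfat.exists_lintegral_ball_enorm_le hF hq hε
  obtain ⟨c, hc, hlow⟩ := exists_mul_lintegral_mul_infEDist_rpow_le volume hF hne
    (q := q + ε + ε) (by linarith)
  obtain ⟨C₂, hC₂, hupp⟩ := exists_lintegral_infEDist_rpow_mul_lintegral_ball_le volume F
    (q := q + ε - 1) (by linarith) hε
  simp only [finrank_euclideanSpace_fin] at hlow hupp
  refine ⟨c⁻¹ * (C₁ * C₂), by positivity, fun u hu hu0 => ?_⟩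
  have hball (x : EuclideanSpace ℝ (Fin n)) :
      infEDist x F ^ (-(q + ε + ε) - n) * ∫⁻ y in ball x (infDist x F), ‖u y‖ₑ ≤
        ENNReal.ofReal C₁ * (infEDist x F ^ (-(n + ε)) *
          ∫⁻ y in ball x (5 * infDist x F), ‖fderiv ℝ u y‖ₑ * infEDist y F ^ (-(q + ε - 1))) := by
    rcases (infDist_nonneg (x := x) (s := F)).eq_or_lt with hx | hx
    · simp [← hx]
    have hpow : infDist x F ^ (-(q + ε + ε) - n) * (C₁ * infDist x F ^ (q + ε)) =
        C₁ * infDist x F ^ (-(n + ε)) := by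
      rw [mul_left_comm, ← Real.rpow_add hx]
      ring_nf
    rw [infEDist_rpow_eq_ofReal hx, infEDist_rpow_eq_ofReal hx, ← mul_assoc,
      ← ENNReal.ofReal_mul hC₁.le, ← hpow, ENNReal.ofReal_mul (by positivity), mul_assoc, neg_sub]
    gcongr
    exact hlocal u hu hu0 x hx
  have hscaled : ENNReal.ofReal c * ∫⁻ x, ‖u x‖ₑ * infEDist x F ^ (-(q + ε + ε)) ≤
      ENNReal.ofReal (C₁ * C₂) * ∫⁻ x, ‖fderiv ℝ u x‖ₑ * infEDist x F ^ (1 - (q + ε + ε)) := by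
    refine (hlow _ hu.continuous.enorm.measurable fun w hw => by simp [hu0 w hw]).trans
      ((lintegral_mono hball).trans ?_)
    rw [lintegral_const_mul' _ _ ENNReal.ofReal_ne_top, ENNReal.ofReal_mul hC₁.le, mul_assoc,
      show 1 - (q + ε + ε) = -(q + ε - 1 + ε) by ring]
    gcongr
    exact hupp _ (hu.continuous_fderiv one_ne_zero).enorm.measurable
  rwa [ENNReal.ofReal_mul (by positivity), ENNReal.ofReal_inv_of_pos hc, mul_assoc,
    ← ENNReal.mul_le_iff_le_inv (ENNReal.ofReal_pos.2 hc).ne' ENNReal.ofReal_ne_top]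

end HardyOne

section HardyPow

theorem le_rpow_mul_of_le_mul_rpow {p : ℝ} (hp : 1 < p) {I J C : ℝ≥0∞} (hI : I ≠ ⊤)
    (h : I ≤ C * (I ^ ((p - 1) / p) * J ^ (1 / p))) : I ≤ C ^ p * J := by
  have hp0 : 0 < p := zero_lt_one.trans hp
  rcases eq_or_ne I 0 with rfl | hI0
  · exact zero_le
  have hsplit : I = I ^ ((p - 1) / p) * I ^ (1 / p) := by
    rw [← ENNReal.rpow_add _ _ hI0 hI, ← add_div, sub_add_cancel, div_self hp0.ne',
      ENNReal.rpow_one]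
  have hfactor : I ^ ((p - 1) / p) * I ^ (1 / p) ≤ I ^ ((p - 1) / p) * (C * J ^ (1 / p)) := by
    rw [← hsplit, mul_left_comm]
    exact h
  have hroot : I ^ (1 / p) ≤ C * J ^ (1 / p) :=
    (ENNReal.mul_le_mul_iff_right (ENNReal.rpow_pos (pos_iff_ne_zero.2 hI0) hI).ne'
      (ENNReal.rpow_ne_top_of_nonneg (div_nonneg (sub_nonneg.2 hp.le) hp0.le) hI)).1 hfactor
  calc I = (I ^ (1 / p)) ^ p := by
        rw [← ENNReal.rpow_mul, one_div_mul_cancel hp0.ne', ENNReal.rpow_one]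
    _ ≤ (C * J ^ (1 / p)) ^ p := ENNReal.rpow_le_rpow hroot hp0.le
    _ = C ^ p * J := by
        rw [ENNReal.mul_rpow_of_nonneg _ _ hp0.le, ← ENNReal.rpow_mul,
          one_div_mul_cancel hp0.ne', ENNReal.rpow_one]

theorem lintegral_rpow_sub_one_mul_mul_rpow_le {X : Type*} [MeasurableSpace X] (μ : Measure X)
    {p : ℝ} (hp : 1 < p) (r : ℝ) {f g d : X → ℝ≥0∞} (hf : Measurable f) (hg : Measurable g)
    (hd : Measurable d) (hd0 : ∀ x, d x = 0 → f x = 0) (hdtop : ∀ x, d x ≠ ⊤) :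
    ∫⁻ x, f x ^ (p - 1) * g x * d x ^ (1 - r) ∂μ ≤
      (∫⁻ x, f x ^ p * d x ^ (-r) ∂μ) ^ ((p - 1) / p) *
        (∫⁻ x, g x ^ p * d x ^ (p - r) ∂μ) ^ (1 / p) := by
  have hp0 : 0 < p := zero_lt_one.trans hp
  have hp1 : 0 < p - 1 := sub_pos.2 hp
  set F : X → ℝ≥0∞ := fun x => f x ^ (p - 1) * d x ^ (-r * ((p - 1) / p))
  set G : X → ℝ≥0∞ := fun x => g x * d x ^ ((p - r) / p)
  have hsplit (x : X) : f x ^ (p - 1) * g x * d x ^ (1 - r) = (F * G) x := by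
    simp only [F, G, Pi.mul_apply]
    rcases eq_or_ne (d x) 0 with hx | hx
    · simp [hd0 x hx, ENNReal.zero_rpow_of_pos hp1]
    · rw [show 1 - r = -r * ((p - 1) / p) + (p - r) / p by field_simp; ring,
        ENNReal.rpow_add _ _ hx (hdtop x)]
      ring
  have hF (x : X) : F x ^ (p / (p - 1)) = f x ^ p * d x ^ (-r) := by
    rw [ENNReal.mul_rpow_of_nonneg _ _ (by positivity), ← ENNReal.rpow_mul, ← ENNReal.rpow_mul,
      mul_div_cancel₀ _ hp1.ne', mul_assoc, div_mul_div_cancel₀ hp0.ne', div_self hp1.ne', mul_one]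
  have hG (x : X) : G x ^ p = g x ^ p * d x ^ (p - r) := by
    rw [ENNReal.mul_rpow_of_nonneg _ _ hp0.le, ← ENNReal.rpow_mul, div_mul_cancel₀ _ hp0.ne']
  have hholder := ENNReal.lintegral_mul_le_Lp_mul_Lq μ (Real.HolderConjugate.conjExponent hp).symm
    (f := F) (g := G) ((hf.pow_const _).mul (hd.pow_const _)).aemeasurable
    (hg.mul (hd.pow_const _)).aemeasurable
  simpa only [hsplit, Real.conjExponent, hF, hG, one_div_div] using hholder

theorem lintegral_enorm_rpow_mul_infEDist_rpow_lt_top {X G : Type*} [PseudoMetricSpace X]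
    [MeasurableSpace X] [OpensMeasurableSpace X] (μ : Measure X) [IsFiniteMeasureOnCompacts μ]
    [NormedAddCommGroup G] {F : Set X} (hF : IsClosed F) (hne : F.Nonempty) {p : ℝ} (hp : 0 < p)
    (s : ℝ) {u : X → G} (hu : Continuous u) (hcs : HasCompactSupport u)
    (hsupp : tsupport u ⊆ Fᶜ) : ∫⁻ x, ‖u x‖ₑ ^ p * infEDist x F ^ s ∂μ < ⊤ := by
  have hpos (x : X) (hx : x ∈ tsupport u) : 0 < infDist x F :=
    (hF.notMem_iff_infDist_pos hne).1 (hsupp hx)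
  have hcont : ContinuousOn (fun x => ‖u x‖ ^ p * infDist x F ^ s) (tsupport u) :=
    (hu.norm.rpow_const fun _ => Or.inr hp.le).continuousOn.mul
      ((continuous_infDist_pt F).continuousOn.rpow_const fun x hx => Or.inl (hpos x hx).ne')
  have hsubset : Function.support (fun x => ‖u x‖ₑ ^ p * infEDist x F ^ s) ⊆ tsupport u := by
    refine Function.support_subset_iff'.2 fun x hx => ?_
    simp [image_eq_zero_of_notMem_tsupport hx, ENNReal.zero_rpow_of_pos hp]
  calc ∫⁻ x, ‖u x‖ₑ ^ p * infEDist x F ^ s ∂μ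
      = ∫⁻ x in tsupport u, ENNReal.ofReal (‖u x‖ ^ p * infDist x F ^ s) ∂μ := by
        rw [← setLIntegral_eq_of_support_subset hsubset]
        refine setLIntegral_congr_fun (isClosed_tsupport u).measurableSet fun x hx => ?_
        rw [infEDist_rpow_eq_ofReal (hpos x hx), enorm_rpow_eq_ofReal_norm_rpow _ hp.le,
          ENNReal.ofReal_mul (by positivity)]
    _ < ⊤ := (hcont.integrableOn_compact' hcs.isCompact
        (isClosed_tsupport u).measurableSet).setLIntegral_lt_top

theorem lintegral_rpow_mul_infEDist_rpow_le {E : Type*} [NormedAddCommGroup E] [NormedSpace ℝ E]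
    [MeasurableSpace E] [OpensMeasurableSpace E] (μ : Measure E) [IsFiniteMeasureOnCompacts μ]
    {F : Set E} (hF : IsClosed F) (hne : F.Nonempty) {r : ℝ} {C : ℝ≥0∞}
    (hone : ∀ v : E → ℝ, ContDiff ℝ 1 v → (∀ w ∈ F, v w = 0) →
      ∫⁻ x, ‖v x‖ₑ * infEDist x F ^ (-r) ∂μ ≤
        C * ∫⁻ x, ‖fderiv ℝ v x‖ₑ * infEDist x F ^ (1 - r) ∂μ)
    {p : ℝ} (hp : 1 ≤ p) {u : E → ℝ} (hu : ContDiff ℝ 1 u) (hcs : HasCompactSupport u)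
    (hsupp : tsupport u ⊆ Fᶜ) :
    ∫⁻ x, ‖u x‖ₑ ^ p * infEDist x F ^ (-r) ∂μ ≤
      (C * ENNReal.ofReal p) ^ p * ∫⁻ x, ‖fderiv ℝ u x‖ₑ ^ p * infEDist x F ^ (p - r) ∂μ := by
  have hu0 (w : E) (hw : w ∈ F) : u w = 0 :=
    image_eq_zero_of_notMem_tsupport fun hmem => hsupp hmem hw
  rcases hp.eq_or_lt with rfl | hp
  · simpa using hone u hu hu0
  have hp0 : 0 < p := zero_lt_one.trans hp
  have hderiv (x : E) : ‖fderiv ℝ (fun x => ‖u x‖ ^ p) x‖ₑ ≤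
      ENNReal.ofReal p * (‖u x‖ₑ ^ (p - 1) * ‖fderiv ℝ u x‖ₑ) := by
    rw [← mul_assoc]
    lift p to ℝ≥0 using hp0.le
    simpa using enorm_fderiv_norm_rpow_le (hu.differentiable one_ne_zero) (mod_cast hp)
  have hd0 (x : E) (hx : infEDist x F = 0) : ‖u x‖ₑ = 0 := by
    rw [hu0 x ((mem_iff_infEDist_zero_of_closed hF).2 hx), enorm_zero]
  refine le_rpow_mul_of_le_mul_rpow hp (lintegral_enorm_rpow_mul_infEDist_rpow_lt_top μ hF hne hp0
    (-r) hu.continuous hcs hsupp).ne ?_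
  calc ∫⁻ x, ‖u x‖ₑ ^ p * infEDist x F ^ (-r) ∂μ
      = ∫⁻ x, ‖‖u x‖ ^ p‖ₑ * infEDist x F ^ (-r) ∂μ := by
        refine lintegral_congr fun x => ?_
        rw [enorm_rpow_eq_ofReal_norm_rpow (u x) hp0.le, Real.enorm_of_nonneg (by positivity)]
    _ ≤ C * ∫⁻ x, ‖fderiv ℝ (fun x => ‖u x‖ ^ p) x‖ₑ * infEDist x F ^ (1 - r) ∂μ :=
        hone _ (hu.norm_rpow hp) fun w hw => by simp [hu0 w hw, hp0.ne']
    _ ≤ C * ∫⁻ x, ENNReal.ofReal p *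
          (‖u x‖ₑ ^ (p - 1) * ‖fderiv ℝ u x‖ₑ * infEDist x F ^ (1 - r)) ∂μ := by
        gcongr C * ?_
        refine lintegral_mono fun x => ?_
        rw [← mul_assoc]
        exact mul_le_mul_left (hderiv x) _
    _ ≤ _ := by
        rw [lintegral_const_mul' _ _ ENNReal.ofReal_ne_top, mul_assoc]
        gcongr
        exact lintegral_rpow_sub_one_mul_mul_rpow_le μ hp r hu.continuous.enorm.measurable
          (hu.continuous_fderiv one_ne_zero).enorm.measurable measurable_infEDist hd0
          fun x => infEDist_ne_top hne

end HardyPow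

section Frontier

theorem infEDist_frontier_eq_infEDist_compl {E : Type*} [NormedAddCommGroup E] [NormedSpace ℝ E]
    [FiniteDimensional ℝ E] {Ω : Set E} (hΩ : IsOpen Ω) {x : E} (hx : x ∈ Ω) :
    infEDist x (frontier Ω) = infEDist x Ωᶜ := by
  rcases Ωᶜ.eq_empty_or_nonempty with hempty | hne
  · simp [Set.compl_empty_iff.1 hempty]
  · obtain ⟨y, hy, hxy⟩ :=
      exists_mem_frontier_infDist_compl_eq_dist hx (Set.nonempty_compl.1 hne)
    refine le_antisymm ?_ (infEDist_anti (hΩ.frontier_eq ▸ fun z hz => hz.2))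
    calc infEDist x (frontier Ω) ≤ edist x y := infEDist_le_edist_of_mem hy
      _ = ENNReal.ofReal (infDist x Ωᶜ) := by rw [hxy, edist_dist]
      _ = infEDist x Ωᶜ := ENNReal.ofReal_toReal (infEDist_ne_top hne)

variable {n : ℕ} {Ω : Set (EuclideanSpace ℝ (Fin n))}

theorem admitsHardyInequality_of_compl (hΩ : IsOpen Ω) {p β : ℝ} (hp : 0 < p) {C : ℝ≥0∞}
    (hC : C ≠ ⊤)
    (hardy : ∀ u : EuclideanSpace ℝ (Fin n) → ℝ, IsTestFunction Ω u →
      ∫⁻ x, ‖u x‖ₑ ^ p * infEDist x Ωᶜ ^ (β - p) ≤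
        C * ∫⁻ x, ‖fderiv ℝ u x‖ₑ ^ p * infEDist x Ωᶜ ^ β) :
    AdmitsHardyInequality p β Ω := by
  lift C to ℝ≥0 using hC
  refine ⟨C + 1, by positivity, fun u hu => ?_⟩
  have hweight (f : EuclideanSpace ℝ (Fin n) → ℝ≥0∞) (s : ℝ) :
      ∫⁻ x in Ω, f x * infEDist x (frontier Ω) ^ s = ∫⁻ x in Ω, f x * infEDist x Ωᶜ ^ s :=
    setLIntegral_congr_fun hΩ.measurableSet fun x hx => by
      rw [infEDist_frontier_eq_infEDist_compl hΩ hx]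
  have hsupp : Function.support (fun x => ‖fderiv ℝ u x‖ₑ ^ p * infEDist x Ωᶜ ^ β) ⊆ Ω := by
    refine Function.support_subset_iff'.2 fun x hx => ?_
    rw [enorm_rpow_eq_ofReal_norm_rpow _ hp.le,
      image_eq_zero_of_notMem_tsupport fun hmem => hx (hu.2.2 (tsupport_fderiv_subset ℝ hmem)),
      norm_zero, Real.zero_rpow hp.ne', ENNReal.ofReal_zero, zero_mul]
  rw [hweight (fun x => ‖u x‖ₑ ^ p), hweight (fun x => ‖fderiv ℝ u x‖ₑ ^ p),
    setLIntegral_eq_of_support_subset hsupp]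
  refine (setLIntegral_le_lintegral Ω _).trans ((hardy u hu).trans ?_)
  gcongr
  exact le_self_add

end Frontier

theorem corollary1p3_general {n : ℕ} {Ω : Set (EuclideanSpace ℝ (Fin n))} (hΩ : IsOpen Ω)
    {q : ℝ} (hq : 1 ≤ q) (hfat : UniformlyFat q Ωᶜ) {p β : ℝ} (hp : 1 ≤ p) (hβ : β < p - q) :
    AdmitsHardyInequality p β Ω := by
  have hp0 : 0 < p := zero_lt_one.trans_le hp
  rcases Ωᶜ.eq_empty_or_nonempty with hempty | hne
  · refine admitsHardyInequality_of_compl hΩ hp0 ENNReal.zero_ne_top fun u _ => ?_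
    simp [hempty, ENNReal.top_rpow_of_neg (by linarith : β - p < 0)]
  · obtain ⟨C, -, hone⟩ := hfat.exists_lintegral_mul_infEDist_rpow_le hΩ.isClosed_compl hne hq
      (r := p - β) (by linarith)
    refine admitsHardyInequality_of_compl hΩ hp0 (C := (ENNReal.ofReal C * ENNReal.ofReal p) ^ p)
      (by finiteness) fun u hu => ?_
    simpa using lintegral_rpow_mul_infEDist_rpow_le volume hΩ.isClosed_compl hne hone hp
      (hu.1.of_le (by simp)) hu.2.1 (by simpa using hu.2.2)

theorem corollary1p3 {n : ℕ} (Ω : Set (EuclideanSpace ℝ (Fin n))) (hΩ : IsOpen Ω)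
    (s : ℝ) (hs : 1 ≤ s) (hfat : ∀ q : ℝ, s < q → UniformlyFat q Ωᶜ)
    (p β : ℝ) (hp : 1 < p) (hβ : β < p - s) :
    AdmitsHardyInequality p β Ω :=
  corollary1p3_general hΩ (q := (s + (p - β)) / 2) (by linarith) (hfat _ (by linarith)) hp.le
    (by linarith)
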